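/- Let $\mathbb{D}=\{z\in\mathbb{C}:|z|<1\}$, let $\alpha>-1$, and let $H$ be a nonzero separable complex Hilbert space. Let $dA$ be the area measure on $\mathbb{D}$ normalized so that $A(\mathbb{D})=1$, and let $dA_\alpha(z)=(\alpha+1)(1-|z|^2)^\alpha\,dA(z)$. The $H$-valued weighted Bergman space $\mathcal{A}^2_\alpha(H)$ is the space of all analytic functions $f:\mathbb{D}\to H$ with $$\|f\|^2=\int_{\mathbb{D}}\|f(z)\|^2\,dA_\alpha(z)<\infty,$$ with the inner product $\langle f,g\rangle=\int_{\mathbb{D}}\langle f(z),g(z)\rangle\,dA_\alpha(z)$. Let $\Phi:\mathbb{D}\to\mathbb{D}$ be analytic. Then $C_\Phi f=f\circ\Phi$ defines a bounded linear operator $C_\Phi$ on $\mathcal{A}^2_\alpha(H)$, and its operator norm satisfies $$\|C_\Phi\|=1\quad\text{if and only if}\quad \Phi(0)=0.$$ -/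

import Mathlib

open MeasureTheory
open scoped ENNReal InnerProductSpace

noncomputable section

namespace VectorBergman

/-- The open unit disk `𝔻 = {z ∈ ℂ : |z| < 1}`, with the subspace topology and Borel sets. -/
abbrev Disk : Type := Metric.ball (0 : ℂ) 1

/-- A function on the open unit disk with values in a complex normed space is analytic. -/
def IsAnalytic {E : Type*} [NormedAddCommGroup E] [NormedSpace ℂ E] (f : Disk → E) : Prop :=
  ∃ F : ℂ → E, AnalyticOnNhd ℂ F (Metric.ball 0 1) ∧ ∀ z : Disk, f z = F z

/-- The normalized area measure `dA = dx dy / π` on the unit disk. -/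
def areaMeasure : Measure Disk :=
  ((ENNReal.ofReal Real.pi)⁻¹ • (volume : Measure ℂ)).comap Subtype.val

/-- The weighted area measure `dA_α(z) = (α + 1) (1 - |z|²)^α dA(z)` on the unit disk. -/
def weightedArea (α : ℝ) : Measure Disk :=
  areaMeasure.withDensity fun z => ENNReal.ofReal ((α + 1) * (1 - ‖(z : ℂ)‖ ^ 2) ^ α)

section Facts

variable {E : Type*} [NormedAddCommGroup E] [NormedSpace ℂ E] {f g : Disk → E} {α : ℝ}

theorem IsAnalytic.continuous (hf : IsAnalytic f) : Continuous f := by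
  obtain ⟨F, hF, hfF⟩ := hf
  have h : f = (Metric.ball (0 : ℂ) 1).domRestrict F := funext hfF
  rw [h]
  exact hF.continuousOn.domRestrict

theorem IsAnalytic.add (hf : IsAnalytic f) (hg : IsAnalytic g) : IsAnalytic (f + g) := by
  obtain ⟨F, hF, hfF⟩ := hf
  obtain ⟨G, hG, hgG⟩ := hg
  exact ⟨F + G, hF.add hG, fun z => by simp [hfF, hgG]⟩

theorem IsAnalytic.const_smul (c : ℂ) (hf : IsAnalytic f) : IsAnalytic (c • f) := by
  obtain ⟨F, hF, hfF⟩ := hf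
  exact ⟨c • F, fun z hz => (hF z hz).const_smul, fun z => by simp [hfF]⟩

theorem isAnalytic_zero : IsAnalytic (0 : Disk → E) :=
  ⟨fun _ => 0, fun _ _ => analyticAt_const, fun _ => rfl⟩

theorem IsAnalytic.memLp_iff (hf : IsAnalytic f) :
    MemLp f 2 (weightedArea α) ↔ Integrable (fun z => ‖f z‖ ^ 2) (weightedArea α) :=
  memLp_two_iff_integrable_sq_norm hf.continuous.aestronglyMeasurable

instance isOpenPosMeasure_areaMeasure : areaMeasure.IsOpenPosMeasure := by
  refine ⟨fun U hU hne => ?_⟩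
  rw [areaMeasure, (MeasurableEmbedding.subtype_coe measurableSet_ball).comap_apply]
  have hU' : IsOpen ((Subtype.val : Disk → ℂ) '' U) :=
    Metric.isOpen_ball.isOpenEmbedding_subtypeVal.isOpenMap U hU
  have := (hU'.measure_pos volume (hne.image _)).ne'
  simp [this]

theorem isOpenPosMeasure_weightedArea (hα : -1 < α) : (weightedArea α).IsOpenPosMeasure := by
  refine (withDensity_absolutelyContinuous' (μ := areaMeasure) ?_ ?_).isOpenPosMeasure
  · refine Measurable.aemeasurable ?_
    fun_prop
  · refine Filter.Eventually.of_forall fun z => ?_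
    have hz : ‖(z : ℂ)‖ < 1 := mem_ball_zero_iff.1 z.2
    have h1 : 0 < 1 - ‖(z : ℂ)‖ ^ 2 := by nlinarith [norm_nonneg (z : ℂ)]
    have h2 : 0 < (α + 1) * (1 - ‖(z : ℂ)‖ ^ 2) ^ α :=
      mul_pos (by linarith) (Real.rpow_pos_of_pos h1 α)
    simpa using h2

end Facts

section Space

variable (α : ℝ) (H : Type*) [NormedAddCommGroup H] [InnerProductSpace ℂ H]

/-- The linear subspace of all analytic `f : 𝔻 → H` with `∫ ‖f(z)‖² dA_α(z) < ∞`. -/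
def bergmanSubmodule : Submodule ℂ (Disk → H) where
  carrier := {f | IsAnalytic f ∧ Integrable (fun z => ‖f z‖ ^ 2) (weightedArea α)}
  zero_mem' := ⟨isAnalytic_zero, by simp⟩
  add_mem' := fun {f g} hf hg => ⟨hf.1.add hg.1,
    (hf.1.add hg.1).memLp_iff.1 ((hf.1.memLp_iff.2 hf.2).add (hg.1.memLp_iff.2 hg.2))⟩
  smul_mem' := fun c f hf => ⟨hf.1.const_smul c,
    (hf.1.const_smul c).memLp_iff.1 ((hf.1.memLp_iff.2 hf.2).const_smul c)⟩

/-- The weighted Bergman space `A²_α(H)`. It is a type synonym of `bergmanSubmodule α H`, so that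
its topology is the one of the norm below and not that of pointwise convergence. -/
def BergmanSpace : Type _ := bergmanSubmodule α H

instance : AddCommGroup (BergmanSpace α H) :=
  inferInstanceAs (AddCommGroup (bergmanSubmodule α H))

instance : Module ℂ (BergmanSpace α H) :=
  inferInstanceAs (Module ℂ (bergmanSubmodule α H))

instance : FunLike (BergmanSpace α H) Disk H where
  coe f := f.1
  coe_injective := Subtype.coe_injective

variable {α H}

theorem BergmanSpace.isAnalytic (f : BergmanSpace α H) : IsAnalytic f := f.2.1

theorem BergmanSpace.integrable (f : BergmanSpace α H) :
    Integrable (fun z => ‖f z‖ ^ 2) (weightedArea α) := f.2.2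

theorem BergmanSpace.memLp (f : BergmanSpace α H) : MemLp f 2 (weightedArea α) :=
  f.isAnalytic.memLp_iff.2 f.integrable

theorem BergmanSpace.add_apply (f g : BergmanSpace α H) (z : Disk) : (f + g) z = f z + g z := rfl

theorem BergmanSpace.smul_apply (c : ℂ) (f : BergmanSpace α H) (z : Disk) :
    (c • f) z = c • f z := rfl

theorem BergmanSpace.zero_apply (z : Disk) : (0 : BergmanSpace α H) z = 0 := rfl

theorem BergmanSpace.integrable_inner (f g : BergmanSpace α H) :
    Integrable (fun z => ⟪f z, g z⟫_ℂ) (weightedArea α) := by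
  refine (L2.integrable_inner (𝕜 := ℂ) f.memLp.toLp g.memLp.toLp).congr ?_
  filter_upwards [f.memLp.coeFn_toLp, g.memLp.coeFn_toLp] with z h1 h2
  rw [h1, h2]

theorem BergmanSpace.integral_inner_self (f : BergmanSpace α H) :
    ∫ z, ⟪f z, f z⟫_ℂ ∂weightedArea α = ((∫ z, ‖f z‖ ^ 2 ∂weightedArea α : ℝ) : ℂ) := by
  rw [← integral_complex_ofReal]
  refine integral_congr_ae (Filter.Eventually.of_forall fun z => ?_)
  simp [inner_self_eq_norm_sq_to_K]

variable (α H)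

/-- The inner product `∫ ⟪f(z), g(z)⟫ dA_α(z)` on `A²_α(H)`. -/
@[reducible]
def BergmanSpace.innerCore [hα : Fact (-1 < α)] : InnerProductSpace.Core ℂ (BergmanSpace α H) where
  inner f g := ∫ z, ⟪f z, g z⟫_ℂ ∂weightedArea α
  conj_inner_symm f g := by
    rw [← integral_conj]
    simp only [inner_conj_symm]
  re_inner_nonneg f := by
    rw [f.integral_inner_self]
    simpa using integral_nonneg fun z => sq_nonneg ‖f z‖
  add_left f g h := by
    rw [← integral_add (f.integrable_inner h) (g.integrable_inner h)]
    simp only [BergmanSpace.add_apply, inner_add_left]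
  smul_left f g c := by
    rw [← integral_const_mul]
    simp only [BergmanSpace.smul_apply, inner_smul_left]
  definite f hf := by
    have h0 : ∫ z, ‖f z‖ ^ 2 ∂weightedArea α = 0 := by
      have := f.integral_inner_self.symm.trans hf
      exact_mod_cast this
    have h1 := (integral_eq_zero_iff_of_nonneg (fun z => sq_nonneg ‖f z‖) f.integrable).1 h0
    have := isOpenPosMeasure_weightedArea hα.out
    have h2 := Measure.eq_of_ae_eq h1 (by have := f.isAnalytic.continuous; fun_prop)
      continuous_zero
    refine DFunLike.ext _ _ fun z => ?_
    simpa [BergmanSpace.zero_apply] using congrFun h2 z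

instance [Fact (-1 < α)] : NormedAddCommGroup (BergmanSpace α H) :=
  @InnerProductSpace.Core.toNormedAddCommGroup ℂ _ _ _ _ (BergmanSpace.innerCore α H)

instance [Fact (-1 < α)] : InnerProductSpace ℂ (BergmanSpace α H) :=
  InnerProductSpace.ofCore (BergmanSpace.innerCore α H).toCore

variable {α H} in
theorem BergmanSpace.norm_sq [Fact (-1 < α)] (f : BergmanSpace α H) :
    ‖f‖ ^ 2 = ∫ z, ‖f z‖ ^ 2 ∂weightedArea α := by
  have h : ⟪f, f⟫_ℂ = ∫ z, ⟪f z, f z⟫_ℂ ∂weightedArea α := rfl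
  rw [f.integral_inner_self, inner_self_eq_norm_sq_to_K] at h
  exact Complex.ofReal_injective (by simpa using h)

end Space

/-- `T` is the composition operator `C_Φ f = f ∘ Φ`, as a bounded operator on `A²_α(H)`. -/
def IsCompositionOperator {α : ℝ} [Fact (-1 < α)] {H : Type*} [NormedAddCommGroup H]
    [InnerProductSpace ℂ H] (Φ : Disk → Disk) (T : BergmanSpace α H →L[ℂ] BergmanSpace α H) :
    Prop :=
  ∀ (f : BergmanSpace α H) (z : Disk), T f z = f (Φ z)

end VectorBergman

end

namespace VectorBergman

/-! ### Littlewood subordination on circles -/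

section Circle

open Metric Set Filter Topology Complex Real

variable {H : Type*} [NormedAddCommGroup H] [InnerProductSpace ℂ H] {F : ℂ → H} {φ : ℂ → ℂ}

/-! If `Φ 0 = 0`, Littlewood subordination applies: `‖F‖²` lies below the Poisson integral `Re h` of
its values on a circle of radius `R`, and the mean of `Re (h ∘ φ)` over a circle of radius `r < R`
is `Re h(0)`, the mean of `‖F‖²` over the larger circle. Letting `R` decrease to `r`
(`circleAverage_norm_sq_comp_le`) and integrating against the radial weight makes composition a
contraction; constants are fixed, so the norm is 1.

For general `Φ`, put `a = Φ 0` and let `σ` be the involutive automorphism exchanging `0` and `a`.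
Then `f ∘ Φ = (f ∘ σ) ∘ (σ ∘ Φ)`, where `σ ∘ Φ` fixes `0`, and a change of variables bounds
composition with `σ` (`lintegral_comp_moebius_le`).

Conversely, testing on `(1 + c z) v` with `c` conjugate to `Φ 0` and `‖v‖ = 1` gives `1 + |Φ 0|² ≤
‖T‖²` (`IsCompositionOperator.one_add_norm_sq_le`), so norm 1 forces `Φ 0 = 0`. -/

theorem circleIntegrable_of_continuousOn_ball {E : Type*} [NormedAddCommGroup E] {f : ℂ → E}
    (hf : ContinuousOn f (ball 0 1)) {r : ℝ} (hr0 : 0 ≤ r) (hr1 : r < 1) :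
    CircleIntegrable f 0 r :=
  (hf.mono fun _ hz => mem_ball_zero_iff.2 ((mem_sphere_zero_iff_norm.1 hz).trans_lt hr1)
    ).circleIntegrable hr0

/-- The squared norm of an analytic function is dominated by the real part of the Herglotz
integral of its boundary values on a circle. -/
theorem norm_sq_le_re_circleAverage_herglotz [CompleteSpace H]
    (hF : DifferentiableOn ℂ F (ball 0 1)) {R : ℝ} (hR : R < 1) {w : ℂ} (hw : w ∈ ball 0 R) :
    ‖F w‖ ^ 2 ≤
      (circleAverage (fun ζ => herglotzRieszKernel 0 w ζ • ((‖F ζ‖ ^ 2 : ℝ) : ℂ)) 0 R).re := by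
  have hR0 : 0 < R := pos_of_mem_ball hw
  have hsub : closedBall (0 : ℂ) R ⊆ ball 0 1 := closedBall_subset_ball hR
  have hc : ContinuousOn F (ball 0 1) := hF.continuousOn
  have hker : ContinuousOn (herglotzRieszKernel 0 w) (sphere 0 R) := by
    simpa [abs_of_pos hR0] using continuousOn_herglotzRieszKernel_sphere hw
  -- `k` is analytic because the inner product is linear in its second slot. Expanding `‖F z - F w‖²
  -- ≥ 0` gives `Re k ≤ ‖F‖²`, with equality at `w`; the Poisson formula for `Re k` and positivity
  -- of the kernel then finish.
  set k : ℂ → ℂ := fun z => 2 * ⟪F w, F z⟫_ℂ - ((‖F w‖ ^ 2 : ℝ) : ℂ) with hk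
  have hkd : DifferentiableOn ℂ k (ball 0 1) := by
    have h1 : DifferentiableOn ℂ (fun z => ⟪F w, F z⟫_ℂ) (ball 0 1) :=
      (innerSL ℂ (F w)).differentiable.comp_differentiableOn hF
    exact (h1.const_mul 2).sub_const _
  have hkcl : DiffContOnCl ℂ k (ball 0 R) :=
    (hkd.mono (by rwa [closure_ball _ hR0.ne'])).diffContOnCl
  have hrep := hkcl.circleAverage_re_herglotzRieszKernel_smul hw
  have hkw : (k w).re = ‖F w‖ ^ 2 := by
    have : ⟪F w, F w⟫_ℂ = ((‖F w‖ ^ 2 : ℝ) : ℂ) := by simp [inner_self_eq_norm_sq_to_K]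
    simp only [hk, this, sub_re, mul_re, re_ofNat, im_ofNat, ofReal_re]
    ring
  have hci : ∀ {E : Type _} [NormedAddCommGroup E] {f : ℂ → E}, ContinuousOn f (sphere 0 R) →
      CircleIntegrable f 0 R := fun h => h.circleIntegrable hR0.le
  have hss : sphere (0 : ℂ) R ⊆ ball 0 1 := sphere_subset_closedBall.trans hsub
  have hker_re : ContinuousOn (re ∘ herglotzRieszKernel 0 w) (sphere 0 R) :=
    continuous_re.comp_continuousOn hker
  have hck : ContinuousOn ((re ∘ herglotzRieszKernel 0 w) • k) (sphere 0 R) :=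
    hker_re.smul (hkd.continuousOn.mono hss)
  have hcu : ContinuousOn (fun z => ‖F z‖ ^ 2) (sphere 0 R) := (hc.mono hss).norm.pow 2
  rw [re_circleAverage_herglotzRieszKernel_smul (hci hcu) hw, ← hkw, ← hrep, ← reCLM_apply,
    ← ContinuousLinearMap.circleAverage_comp_comm _ (hci hck)]
  refine circleAverage_mono (hci (reCLM.continuous.comp_continuousOn hck))
    (hci (hker_re.smul hcu)) fun z hz => ?_
  rw [abs_of_pos hR0] at hz
  have hpos : 0 ≤ (herglotzRieszKernel 0 w z).re := by
    have h1 := le_re_herglotzRieszKernel hz hw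
    have h2 : ‖w‖ < R := mem_ball_zero_iff.1 hw
    refine le_trans ?_ h1
    rw [sub_zero]
    exact div_nonneg (by linarith) (by positivity)
  have hle : (k z).re ≤ ‖F z‖ ^ 2 := by
    have h1 : ‖F z - F w‖ ^ 2 = ‖F z‖ ^ 2 - 2 * (⟪F w, F z⟫_ℂ).re + ‖F w‖ ^ 2 := by
      rw [norm_sub_rev, @norm_sub_sq ℂ]
      simp only [RCLike.re_to_complex]
      ring
    have h2 : (k z).re = 2 * (⟪F w, F z⟫_ℂ).re - ‖F w‖ ^ 2 := by
      simp only [hk, sub_re, mul_re, re_ofNat, im_ofNat, ofReal_re]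
      ring
    nlinarith [sq_nonneg ‖F z - F w‖]
  simpa using mul_le_mul_of_nonneg_left hle hpos

theorem norm_le_norm_of_mapsTo_unit_ball (hφ : DifferentiableOn ℂ φ (ball 0 1))
    (hmap : MapsTo φ (ball 0 1) (ball 0 1)) (h0 : φ 0 = 0) {z : ℂ} (hz : ‖z‖ < 1) :
    ‖φ z‖ ≤ ‖z‖ :=
  norm_le_norm_of_mapsTo_ball hφ (fun _ hw => ball_subset_closedBall (hmap hw)) h0 hz

/-- Littlewood's subordination inequality on circles, for the squared norm. -/
theorem circleAverage_norm_sq_comp_le [CompleteSpace H] (hF : DifferentiableOn ℂ F (ball 0 1))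
    (hφ : DifferentiableOn ℂ φ (ball 0 1)) (hmap : MapsTo φ (ball 0 1) (ball 0 1))
    (h0 : φ 0 = 0) {r : ℝ} (hr0 : 0 ≤ r) (hr1 : r < 1) :
    circleAverage (fun z => ‖F (φ z)‖ ^ 2) 0 r ≤ circleAverage (fun z => ‖F z‖ ^ 2) 0 r := by
  have hu : ContinuousOn (fun z => ‖F z‖ ^ 2) (ball 0 1) := hF.continuousOn.norm.pow 2
  have huφ : ContinuousOn (fun z => ‖F (φ z)‖ ^ 2) (ball 0 1) :=
    hu.comp hφ.continuousOn hmap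
  -- The majorant is analytic only in the open disk of radius `R`, so `R > r` is needed; by Schwarz,
  -- `φ` then maps the closed disk of radius `r` into it.
  have step : ∀ R ∈ Ioo r 1, circleAverage (fun z => ‖F (φ z)‖ ^ 2) 0 r ≤
      circleAverage (fun z => ‖F z‖ ^ 2) 0 R := by
    rintro R ⟨hrR, hR1⟩
    have hR0 : 0 < R := hr0.trans_lt hrR
    have hgi : CircleIntegrable (fun z => ((‖F z‖ ^ 2 : ℝ) : ℂ)) 0 R :=
      circleIntegrable_of_continuousOn_ball (continuous_ofReal.comp_continuousOn hu) hR0.le hR1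
    set h : ℂ → ℂ := fun w =>
      circleAverage (fun ζ => herglotzRieszKernel 0 w ζ • ((‖F ζ‖ ^ 2 : ℝ) : ℂ)) 0 R with hh
    have hd : DifferentiableOn ℂ h (ball 0 R) :=
      differentiableOn_circleAverage_herglotzRieszKernel_smul hgi
    have hball : closedBall (0 : ℂ) r ⊆ ball 0 1 := closedBall_subset_ball hr1
    have hmaps : MapsTo φ (closedBall 0 r) (ball 0 R) := fun z hz => by
      have hz' : ‖z‖ ≤ r := mem_closedBall_zero_iff.1 hz
      exact mem_ball_zero_iff.2 <| (norm_le_norm_of_mapsTo_unit_ball hφ hmap h0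
        (hz'.trans_lt hr1)).trans_lt (hz'.trans_lt hrR)
    have hcomp : DifferentiableOn ℂ (h ∘ φ) (closedBall 0 r) := hd.comp (hφ.mono hball) hmaps
    have hint : CircleIntegrable (h ∘ φ) 0 r :=
      (hcomp.continuousOn.mono sphere_subset_closedBall).circleIntegrable hr0
    have hcl : DiffContOnCl ℂ (h ∘ φ) (ball 0 |r|) := by
      rw [abs_of_nonneg hr0]
      exact (hcomp.mono closure_ball_subset_closedBall).diffContOnCl
    have hmean : (circleAverage (h ∘ φ) 0 r).re = circleAverage (fun z => ‖F z‖ ^ 2) 0 R := by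
      rw [hcl.circleAverage, Function.comp_apply, h0, hh,
        re_circleAverage_herglotzRieszKernel_smul
          (circleIntegrable_of_continuousOn_ball hu hR0.le hR1) (mem_ball_self hR0)]
      -- At `w = 0` the kernel is 1 on the circle.
      refine circleAverage_congr_sphere fun z hz => ?_
      have hz0 : z ≠ 0 := by
        rintro rfl
        simp only [mem_sphere, dist_self] at hz
        exact (abs_pos.2 hR0.ne').ne hz
      simp [herglotzRieszKernel, hz0]
    rw [← hmean, ← reCLM_apply, ← ContinuousLinearMap.circleAverage_comp_comm _ hint]
    refine circleAverage_mono (circleIntegrable_of_continuousOn_ball huφ hr0 hr1)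
      ((reCLM.continuous.comp_continuousOn
        (hcomp.continuousOn.mono sphere_subset_closedBall)).circleIntegrable hr0) fun z hz => ?_
    rw [abs_of_nonneg hr0] at hz
    exact norm_sq_le_re_circleAverage_herglotz hF hR1 (hmaps (sphere_subset_closedBall hz))
  have hcont : ContinuousOn (circleAverage (fun z => ‖F z‖ ^ 2) 0) (Ico 0 1) :=
    ContinuousOn.circleAverage (hu.mono fun z hz => by simpa using hz.2) fun _ h => h.1
  have hlim : Tendsto (circleAverage (fun z => ‖F z‖ ^ 2) 0) (𝓝[>] r)
      (𝓝 (circleAverage (fun z => ‖F z‖ ^ 2) 0 r)) := by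
    have h1 : Ioo r 1 ⊆ Ico (0 : ℝ) 1 := fun x hx => ⟨hr0.trans hx.1.le, hx.2⟩
    rw [← nhdsWithin_Ioo_eq_nhdsGT hr1]
    exact (hcont r ⟨hr0, hr1⟩).mono_left (nhdsWithin_mono _ h1)
  refine ge_of_tendsto hlim ?_
  filter_upwards [Ioo_mem_nhdsGT hr1] with R hR using step R hR

end Circle

end VectorBergman

namespace VectorBergman

/-! ### Polar coordinates and the weighted measure -/

section Measure

open Metric Set Complex Real

theorem lintegral_weightedArea (α : ℝ) (G : ℂ → ℝ≥0∞) :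
    ∫⁻ z : Disk, G z ∂weightedArea α = (ENNReal.ofReal π)⁻¹ *
      ∫⁻ z in ball (0 : ℂ) 1, ENNReal.ofReal ((α + 1) * (1 - ‖z‖ ^ 2) ^ α) * G z := by
  rw [weightedArea, lintegral_withDensity_eq_lintegral_mul_non_measurable _ (by fun_prop)
    (by simp), areaMeasure]
  simp only [Pi.mul_apply]
  rw [lintegral_subtype_comap measurableSet_ball
    (fun z : ℂ => ENNReal.ofReal ((α + 1) * (1 - ‖z‖ ^ 2) ^ α) * G z)]
  simp

theorem setLIntegral_ball_polar {G : ℂ → ℝ≥0∞} (hG : Measurable G) :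
    ∫⁻ z in ball (0 : ℂ) 1, G z =
      ∫⁻ r in Ioo (0 : ℝ) 1, ENNReal.ofReal r * ∫⁻ θ in Ioo (-π) π, G (circleMap 0 r θ) := by
  have hind : Measurable ((ball (0 : ℂ) 1).indicator G) := hG.indicator measurableSet_ball
  have hsymm : ∀ p : ℝ × ℝ, Complex.polarCoord.symm p = circleMap 0 p.1 p.2 := fun p => by
    rw [Complex.polarCoord_symm_apply, circleMap_zero, exp_mul_I]
    push_cast
    ring
  have hcm : Measurable fun p : ℝ × ℝ => circleMap 0 p.1 p.2 := by
    unfold circleMap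
    fun_prop
  rw [← lintegral_indicator measurableSet_ball, ← Complex.lintegral_comp_polarCoord_symm,
    polarCoord_target, Measure.volume_eq_prod, ← Measure.prod_restrict]
  simp only [hsymm, smul_eq_mul]
  rw [lintegral_prod _ (by exact ((by fun_prop : Measurable fun p : ℝ × ℝ => ENNReal.ofReal p.1).mul
      (hind.comp hcm)).aemeasurable),
    ← lintegral_indicator measurableSet_Ioi, ← lintegral_indicator measurableSet_Ioo]
  congr 1 with r
  by_cases hr0 : 0 < r
  · rw [indicator_of_mem (mem_Ioi.2 hr0)]
    have hmem : ∀ θ, circleMap 0 r θ ∈ ball (0 : ℂ) 1 ↔ r < 1 := fun θ => by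
      simp [abs_of_pos hr0]
    by_cases hr1 : r < 1
    · rw [indicator_of_mem (mem_Ioo.2 ⟨hr0, hr1⟩), ← lintegral_const_mul']
      · simp [indicator_of_mem ((hmem _).2 hr1)]
      · simp
    · rw [indicator_of_notMem fun h => hr1 h.2]
      simp [indicator_of_notMem fun h => hr1 ((hmem _).1 h)]
  · rw [indicator_of_notMem (by simpa using hr0), indicator_of_notMem fun h => hr0 h.1]

/-- Periodicity reconciles the angular range `(-π, π)` of polar coordinates with the range `(0, 2π)`
of circle averages. -/
theorem lintegral_circleMap_eq {u : ℂ → ℝ} {r : ℝ} (hu : CircleIntegrable u 0 r)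
    (hpos : ∀ z, 0 ≤ u z) :
    ∫⁻ θ in Ioo (-π) π, ENNReal.ofReal (u (circleMap 0 r θ)) =
      ENNReal.ofReal (2 * π * Real.circleAverage u 0 r) := by
  have hper : Function.Periodic (fun θ => u (circleMap 0 r θ)) (2 * π) := fun θ => by
    simp [periodic_circleMap 0 r θ]
  have hii : IntervalIntegrable (fun θ => u (circleMap 0 r θ)) volume (-π) π :=
    hper.intervalIntegrable₀ two_pi_pos.ne' hu _ _
  have heq : ∫ θ in (-π)..π, u (circleMap 0 r θ) = 2 * π * Real.circleAverage u 0 r := by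
    have h1 := hper.intervalIntegral_add_eq (-π) 0
    rw [show -π + 2 * π = π by ring, zero_add] at h1
    rw [h1, circleAverage_def, smul_eq_mul, mul_inv_cancel_left₀ two_pi_pos.ne']
  rw [← heq, intervalIntegral.integral_of_le (by linarith [pi_pos]),
    ← restrict_Ioo_eq_restrict_Ioc, ofReal_integral_eq_lintegral_ofReal]
  · rw [intervalIntegrable_iff_integrableOn_Ioo_of_le (by linarith [pi_pos])] at hii
    exact hii
  · exact Filter.Eventually.of_forall fun θ => hpos _

theorem measurable_indicator_ball_norm_sq {E : Type*} [NormedAddCommGroup E] {F : ℂ → E}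
    (hF : ContinuousOn F (ball 0 1)) :
    Measurable ((ball (0 : ℂ) 1).indicator fun z => ENNReal.ofReal (‖F z‖ ^ 2)) := by
  classical
  rw [← piecewise_eq_indicator]
  exact ContinuousOn.measurable_piecewise
    (ENNReal.continuous_ofReal.comp_continuousOn (hF.norm.pow 2)) continuousOn_const
    measurableSet_ball

/-- The integral of `‖F‖²` over the disk in terms of its averages over circles. -/
theorem lintegral_weightedArea_norm_sq {E : Type*} [NormedAddCommGroup E] (α : ℝ) {F : ℂ → E}
    (hF : ContinuousOn F (ball 0 1)) :
    ∫⁻ z : Disk, ENNReal.ofReal (‖F z‖ ^ 2) ∂weightedArea α = (ENNReal.ofReal π)⁻¹ *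
      ∫⁻ r in Ioo (0 : ℝ) 1, ENNReal.ofReal r * (ENNReal.ofReal ((α + 1) * (1 - r ^ 2) ^ α) *
        ENNReal.ofReal (2 * π * Real.circleAverage (fun z => ‖F z‖ ^ 2) 0 r)) := by
  -- Nothing is known about `F` off the disk; cutting it off gives the global measurability that
  -- polar coordinates require.
  set G := (ball (0 : ℂ) 1).indicator fun z => ENNReal.ofReal (‖F z‖ ^ 2)
  have hG : Measurable G := measurable_indicator_ball_norm_sq hF
  have hGz : ∀ z ∈ ball (0 : ℂ) 1, G z = ENNReal.ofReal (‖F z‖ ^ 2) := fun z hz =>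
    indicator_of_mem hz _
  rw [lintegral_congr fun z : Disk => (hGz z z.2).symm, lintegral_weightedArea,
    setLIntegral_ball_polar (G := fun z => ENNReal.ofReal ((α + 1) * (1 - ‖z‖ ^ 2) ^ α) * G z)
      (Measurable.mul (by fun_prop) hG)]
  congr 1
  refine setLIntegral_congr_fun measurableSet_Ioo fun r hr => ?_
  have hnorm : ∀ θ, ‖circleMap 0 r θ‖ = r := fun θ => by simp [abs_of_pos hr.1]
  have hmem : ∀ θ, circleMap 0 r θ ∈ ball (0 : ℂ) 1 := fun θ =>
    mem_ball_zero_iff.2 ((hnorm θ).trans_lt hr.2)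
  simp only [hnorm, hGz _ (hmem _)]
  rw [lintegral_const_mul' _ _ ENNReal.ofReal_ne_top,
    lintegral_circleMap_eq (u := fun z => ‖F z‖ ^ 2)
      (circleIntegrable_of_continuousOn_ball (hF.norm.pow 2) hr.1.le hr.2)
      fun z => by positivity]

/-- The weight is radial, so the inequality on each circle integrates. Both sides may be infinite.
-/
theorem lintegral_norm_sq_comp_le_of_map_zero {H : Type*} [NormedAddCommGroup H]
    [InnerProductSpace ℂ H] [CompleteSpace H] (α : ℝ) {f : Disk → H} (hf : IsAnalytic f)
    {Φ : Disk → Disk} (hΦ : IsAnalytic fun z => (Φ z : ℂ)) (h0 : Φ 0 = 0) :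
    ∫⁻ z, ENNReal.ofReal (‖f (Φ z)‖ ^ 2) ∂weightedArea α ≤
      ∫⁻ z, ENNReal.ofReal (‖f z‖ ^ 2) ∂weightedArea α := by
  obtain ⟨F, hF, hfF⟩ := hf
  obtain ⟨φ, hφ, hΦφ⟩ := hΦ
  have hmap : MapsTo φ (ball 0 1) (ball 0 1) := fun z hz => by
    rw [← hΦφ ⟨z, hz⟩]
    exact (Φ _).2
  have hφ0 : φ 0 = 0 := by
    simpa [h0] using (hΦφ 0).symm
  simp only [hfF, hΦφ]
  rw [lintegral_weightedArea_norm_sq (F := fun z => F (φ z)) α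
      (hF.continuousOn.comp hφ.continuousOn hmap),
    lintegral_weightedArea_norm_sq α hF.continuousOn]
  gcongr (ENNReal.ofReal π)⁻¹ * ?_
  refine setLIntegral_mono' measurableSet_Ioo fun r hr => ?_
  have := circleAverage_norm_sq_comp_le hF.differentiableOn hφ.differentiableOn hmap hφ0
    hr.1.le hr.2
  gcongr

/-- For `α < 0` the density is unbounded, but the radial integrand is up to a constant the
nonnegative derivative of `-(1 - r²)^(α+1)`, which is continuous up to `r = 1`. -/
theorem measure_weightedArea_univ_lt_top {α : ℝ} (hα : -1 < α) :
    weightedArea α univ < ∞ := by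
  have h := lintegral_weightedArea_norm_sq (F := fun _ => (1 : ℂ)) α continuousOn_const
  simp only [norm_one, one_pow, ENNReal.ofReal_one, lintegral_const, one_mul] at h
  rw [h]
  refine ENNReal.mul_lt_top (by simp [pi_pos]) ?_
  have hint : IntegrableOn (fun r : ℝ => 2 * (α + 1) * (r * (1 - r ^ 2) ^ α)) (Ioc 0 1) := by
    refine intervalIntegral.integrableOn_deriv_of_nonneg
      (g := fun r : ℝ => -(1 - r ^ 2) ^ (α + 1)) ?_ ?_ ?_
    · refine ContinuousOn.neg (ContinuousOn.rpow_const (by fun_prop) fun x _ => Or.inr ?_)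
      linarith
    · intro r hr
      have h1 : 0 < 1 - r ^ 2 := by nlinarith [hr.1, hr.2]
      have h2 : HasDerivAt (fun r : ℝ => 1 - r ^ 2) (-(2 * r)) r := by
        simpa using (hasDerivAt_pow 2 r).const_sub 1
      refine (h2.rpow_const (p := α + 1) (Or.inl h1.ne')).neg.congr_deriv ?_
      rw [add_sub_cancel_right]
      ring
    · intro r hr
      have h1 : 0 < 1 - r ^ 2 := by nlinarith [hr.1, hr.2]
      have h2 : 0 < α + 1 := by linarith
      have := hr.1
      positivity
  have hint' := ((hint.mono_set Ioo_subset_Ioc_self).const_mul π).lintegral_lt_top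
  refine lt_of_eq_of_lt (setLIntegral_congr_fun measurableSet_Ioo fun r hr => ?_) hint'
  have h1 : 0 < 1 - r ^ 2 := by nlinarith [hr.1, hr.2]
  have h2 : 0 < α + 1 := by linarith
  have h3 := hr.1
  simp only [circleAverage_const]
  rw [← ENNReal.ofReal_mul (by positivity), ← ENNReal.ofReal_mul (by positivity)]
  congr 1
  ring

end Measure

end VectorBergman

noncomputable section

namespace VectorBergman

/-! ### Disk automorphisms and change of variables -/

section Moebius

open Metric Set Complex

/-- The involutive disk automorphism exchanging `0` and `a`. -/
def moebius (a z : ℂ) : ℂ := (a - z) / (1 - (starRingEnd ℂ) a * z)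

variable {a z : ℂ}

theorem one_sub_conj_mul_ne_zero (ha : ‖a‖ < 1) (hz : ‖z‖ < 1) :
    1 - (starRingEnd ℂ) a * z ≠ 0 := by
  intro h
  have h1 : ‖(starRingEnd ℂ) a * z‖ = 1 := by rw [← sub_eq_zero.1 h, norm_one]
  rw [norm_mul, RCLike.norm_conj] at h1
  nlinarith [norm_nonneg a, norm_nonneg z]

theorem one_sub_norm_moebius_sq (ha : ‖a‖ < 1) (hz : ‖z‖ < 1) :
    1 - ‖moebius a z‖ ^ 2 =
      (1 - ‖a‖ ^ 2) * (1 - ‖z‖ ^ 2) / ‖1 - (starRingEnd ℂ) a * z‖ ^ 2 := by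
  have h := norm_ne_zero_iff.2 (one_sub_conj_mul_ne_zero ha hz)
  rw [moebius, norm_div, div_pow, eq_div_iff (by positivity), sub_mul,
    div_mul_cancel₀ _ (by positivity)]
  simp only [Complex.sq_norm, normSq_apply, sub_re, sub_im, mul_re, mul_im, conj_re, conj_im,
    one_re, one_im]
  ring

theorem norm_moebius_lt_one (ha : ‖a‖ < 1) (hz : ‖z‖ < 1) : ‖moebius a z‖ < 1 := by
  have h := norm_pos_iff.2 (one_sub_conj_mul_ne_zero ha hz)
  have h1 : 0 < 1 - ‖a‖ ^ 2 := by nlinarith [norm_nonneg a]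
  have h2 : 0 < 1 - ‖z‖ ^ 2 := by nlinarith [norm_nonneg z]
  have h3 : 0 < 1 - ‖moebius a z‖ ^ 2 := by
    rw [one_sub_norm_moebius_sq ha hz]
    positivity
  nlinarith [norm_nonneg (moebius a z)]

theorem moebius_moebius (ha : ‖a‖ < 1) (hz : ‖z‖ < 1) : moebius a (moebius a z) = z := by
  have h1 := one_sub_conj_mul_ne_zero ha hz
  have h2 := one_sub_conj_mul_ne_zero ha (norm_moebius_lt_one ha hz)
  have h3 : moebius a z * (1 - (starRingEnd ℂ) a * z) = a - z := div_mul_cancel₀ _ h1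
  rw [moebius, div_eq_iff h2]
  linear_combination -h3

theorem moebius_self (a : ℂ) : moebius a a = 0 := by simp [moebius]

theorem hasDerivAt_moebius (ha : ‖a‖ < 1) (hz : ‖z‖ < 1) :
    HasDerivAt (moebius a)
      (((‖a‖ ^ 2 - 1 : ℝ) : ℂ) / (1 - (starRingEnd ℂ) a * z) ^ 2) z := by
  have h := one_sub_conj_mul_ne_zero ha hz
  have h1 : HasDerivAt (fun w : ℂ => a - w) (-1) z := (hasDerivAt_id z).const_sub a
  have h2 : HasDerivAt (fun w : ℂ => 1 - (starRingEnd ℂ) a * w) (-(starRingEnd ℂ) a) z := by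
    simpa using ((hasDerivAt_id z).const_mul ((starRingEnd ℂ) a)).const_sub 1
  refine (h1.div h2 h).congr_deriv ?_
  have h3 : ((‖a‖ ^ 2 - 1 : ℝ) : ℂ) = (starRingEnd ℂ) a * a - 1 := by
    push_cast
    rw [conj_mul']
  rw [h3]
  ring

theorem analyticOnNhd_moebius (ha : ‖a‖ < 1) : AnalyticOnNhd ℂ (moebius a) (ball 0 1) :=
  DifferentiableOn.analyticOnNhd (fun _ hz => (hasDerivAt_moebius ha
    (mem_ball_zero_iff.1 hz)).differentiableAt.differentiableWithinAt) isOpen_ball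

/-- The area formula for a holomorphic injective map. -/
theorem setLIntegral_image_eq_of_hasDerivAt {s : Set ℂ} (hs : MeasurableSet s) {f f' : ℂ → ℂ}
    (hf : ∀ z ∈ s, HasDerivAt f (f' z) z) (hinj : InjOn f s) (g : ℂ → ℝ≥0∞) :
    ∫⁻ z in f '' s, g z = ∫⁻ z in s, ENNReal.ofReal (‖f' z‖ ^ 2) * g (f z) := by
  rw [lintegral_image_eq_lintegral_abs_det_fderiv_mul volume hs
    (fun z hz => ((hf z hz).complexToReal_fderiv).hasFDerivWithinAt) hinj]
  refine setLIntegral_congr_fun hs fun z _ => ?_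
  -- The real determinant of multiplication by a complex number is its norm from `ℂ` to `ℝ`.
  have h : (f' z • (1 : ℂ →L[ℝ] ℂ)).det = ‖f' z‖ ^ 2 := by
    have : ((f' z • (1 : ℂ →L[ℝ] ℂ) : ℂ →L[ℝ] ℂ) : ℂ →ₗ[ℝ] ℂ) = Algebra.lmul ℝ ℂ (f' z) := by
      ext; simp
    rw [ContinuousLinearMap.det, this, ← Algebra.norm_apply, Algebra.norm_complex_eq]
    exact Complex.normSq_eq_norm_sq _
  simp only [h, abs_of_nonneg (sq_nonneg ‖f' z‖)]

/-- With `A`, `Z`, `D` as in the proof, the derivative has modulus `A / D` and `1 - ‖moebius a z‖² =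
A Z / D`, so the two weights differ by the factor `(D / A)^(α+2)`. Here `D ≤ 4` and `α + 2 > 0`. -/
theorem moebius_weight_le {α : ℝ} (hα : -1 < α) (ha : ‖a‖ < 1) (hz : ‖z‖ < 1) :
    (α + 1) * (1 - ‖z‖ ^ 2) ^ α ≤ (4 / (1 - ‖a‖ ^ 2)) ^ (α + 2) *
      (‖((‖a‖ ^ 2 - 1 : ℝ) : ℂ) / (1 - (starRingEnd ℂ) a * z) ^ 2‖ ^ 2 *
        ((α + 1) * (1 - ‖moebius a z‖ ^ 2) ^ α)) := by
  have hA : 0 < 1 - ‖a‖ ^ 2 := by nlinarith [norm_nonneg a]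
  have hZ : 0 < 1 - ‖z‖ ^ 2 := by nlinarith [norm_nonneg z]
  have hD := norm_pos_iff.2 (one_sub_conj_mul_ne_zero ha hz)
  have hD2 : ‖1 - (starRingEnd ℂ) a * z‖ ≤ 2 := by
    refine (norm_sub_le _ _).trans ?_
    rw [norm_one, norm_mul, RCLike.norm_conj]
    nlinarith [norm_nonneg a, norm_nonneg z]
  have hder : ‖((‖a‖ ^ 2 - 1 : ℝ) : ℂ) / (1 - (starRingEnd ℂ) a * z) ^ 2‖ =
      (1 - ‖a‖ ^ 2) / ‖1 - (starRingEnd ℂ) a * z‖ ^ 2 := by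
    rw [norm_div, norm_pow, norm_real, Real.norm_eq_abs, abs_sub_comm, abs_of_pos hA]
  rw [hder, one_sub_norm_moebius_sq ha hz]
  set A := 1 - ‖a‖ ^ 2
  set Z := 1 - ‖z‖ ^ 2
  set D := ‖1 - (starRingEnd ℂ) a * z‖ ^ 2
  have hDpos : 0 < D := by positivity
  have hD4 : D ≤ 4 := by nlinarith
  have h1 : (A * Z / D) ^ α = (A / D) ^ α * Z ^ α := by
    rw [← Real.mul_rpow (by positivity) hZ.le]
    ring_nf
  have h2 : (A / D) ^ 2 * (A / D) ^ α = (A / D) ^ (α + 2) := by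
    rw [Real.rpow_add (by positivity), Real.rpow_two, mul_comm]
  have h3 : (4 / A) ^ (α + 2) * (A / D) ^ (α + 2) = (4 / D) ^ (α + 2) := by
    rw [← Real.mul_rpow (by positivity) (by positivity)]
    congr 1
    field_simp
  have h4 : 1 ≤ (4 / D) ^ (α + 2) :=
    Real.one_le_rpow ((one_le_div hDpos).2 hD4) (by linarith)
  have h5 : 0 ≤ (α + 1) * Z ^ α := mul_nonneg (by linarith) (by positivity)
  calc (α + 1) * Z ^ α ≤ (4 / D) ^ (α + 2) * ((α + 1) * Z ^ α) := le_mul_of_one_le_left h5 h4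
    _ = (4 / A) ^ (α + 2) * ((A / D) ^ 2 * ((α + 1) * (A * Z / D) ^ α)) := by
      rw [h1, ← h3, ← h2]
      ring

/-- The area formula is applied to the right-hand integral, so `G` need not be measurable. -/
theorem lintegral_comp_moebius_le {α : ℝ} (hα : -1 < α) (ha : ‖a‖ < 1) (G : ℂ → ℝ≥0∞) :
    ∫⁻ z : Disk, G (moebius a z) ∂weightedArea α ≤
      ENNReal.ofReal ((4 / (1 - ‖a‖ ^ 2)) ^ (α + 2)) * ∫⁻ z : Disk, G z ∂weightedArea α := by
  have hinv : LeftInvOn (moebius a) (moebius a) (ball 0 1) := fun z hz =>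
    moebius_moebius ha (mem_ball_zero_iff.1 hz)
  have hmaps : MapsTo (moebius a) (ball 0 1) (ball 0 1) := fun z hz =>
    mem_ball_zero_iff.2 (norm_moebius_lt_one ha (mem_ball_zero_iff.1 hz))
  have himage : moebius a '' ball 0 1 = ball 0 1 :=
    (hmaps.image_subset).antisymm fun z hz => ⟨_, hmaps hz, hinv hz⟩
  have hA : 0 < 1 - ‖a‖ ^ 2 := by nlinarith [norm_nonneg a]
  rw [lintegral_weightedArea α fun z => G (moebius a z), lintegral_weightedArea, mul_left_comm]
  gcongr (ENNReal.ofReal Real.pi)⁻¹ * ?_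
  conv_rhs => rw [← himage, setLIntegral_image_eq_of_hasDerivAt measurableSet_ball
    (fun z hz => hasDerivAt_moebius ha (mem_ball_zero_iff.1 hz)) hinv.injOn]
  rw [← lintegral_const_mul' _ _ ENNReal.ofReal_ne_top]
  refine setLIntegral_mono' measurableSet_ball fun z hz => ?_
  rw [← mul_assoc, ← mul_assoc, ← ENNReal.ofReal_mul (by positivity),
    ← ENNReal.ofReal_mul (by positivity), mul_assoc]
  exact mul_le_mul' (ENNReal.ofReal_le_ofReal (moebius_weight_le hα ha (mem_ball_zero_iff.1 hz)))
    le_rfl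

end Moebius

end VectorBergman

end

noncomputable section

namespace VectorBergman

/-! ### The composition operator and its upper bounds -/

section Composition

open Metric Set Complex

theorem IsAnalytic.comp {E : Type*} [NormedAddCommGroup E] [NormedSpace ℂ E] {f : Disk → E}
    (hf : IsAnalytic f) {Φ : Disk → Disk} (hΦ : IsAnalytic fun z => (Φ z : ℂ)) :
    IsAnalytic (f ∘ Φ) := by
  obtain ⟨F, hF, hfF⟩ := hf
  obtain ⟨φ, hφ, hΦφ⟩ := hΦ
  refine ⟨F ∘ φ, hF.comp hφ fun z hz => ?_, fun z => ?_⟩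
  · rw [← hΦφ ⟨z, hz⟩]
    exact (Φ _).2
  · rw [Function.comp_apply, Function.comp_apply, hfF, ← hΦφ]

/-- The disk automorphism `moebius a` as a self-map of the disk. -/
def moebiusDisk (a z : Disk) : Disk :=
  ⟨moebius a z, mem_ball_zero_iff.2
    (norm_moebius_lt_one (mem_ball_zero_iff.1 a.2) (mem_ball_zero_iff.1 z.2))⟩

theorem isAnalytic_moebiusDisk (a : Disk) : IsAnalytic fun z => (moebiusDisk a z : ℂ) :=
  ⟨moebius a, analyticOnNhd_moebius (mem_ball_zero_iff.1 a.2), fun _ => rfl⟩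

theorem moebiusDisk_moebiusDisk (a z : Disk) : moebiusDisk a (moebiusDisk a z) = z :=
  Subtype.ext (moebius_moebius (mem_ball_zero_iff.1 a.2) (mem_ball_zero_iff.1 z.2))

theorem moebiusDisk_self (a : Disk) : moebiusDisk a a = 0 := Subtype.ext (moebius_self _)

variable {α : ℝ} {H : Type*} [NormedAddCommGroup H] [InnerProductSpace ℂ H]

theorem exists_lintegral_norm_sq_comp_le [CompleteSpace H] (hα : -1 < α) {Φ : Disk → Disk}
    (hΦ : IsAnalytic fun z => (Φ z : ℂ)) :
    ∃ C : ℝ, 0 ≤ C ∧ ∀ f : Disk → H, IsAnalytic f →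
      ∫⁻ z, ENNReal.ofReal (‖f (Φ z)‖ ^ 2) ∂weightedArea α ≤
        ENNReal.ofReal (C ^ 2) * ∫⁻ z, ENNReal.ofReal (‖f z‖ ^ 2) ∂weightedArea α := by
  set a := Φ 0
  have ha1 : ‖(a : ℂ)‖ < 1 := mem_ball_zero_iff.1 a.2
  have hA : 0 < 1 - ‖(a : ℂ)‖ ^ 2 := by nlinarith [norm_nonneg (a : ℂ)]
  refine ⟨√((4 / (1 - ‖(a : ℂ)‖ ^ 2)) ^ (α + 2)), Real.sqrt_nonneg _, fun f hf => ?_⟩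
  rw [Real.sq_sqrt (by positivity)]
  have h1 := lintegral_norm_sq_comp_le_of_map_zero α (hf.comp (isAnalytic_moebiusDisk a))
    (Φ := moebiusDisk a ∘ Φ) ((isAnalytic_moebiusDisk a).comp hΦ) (moebiusDisk_self a)
  simp only [Function.comp_apply, moebiusDisk_moebiusDisk] at h1
  refine h1.trans ?_
  obtain ⟨F, -, hfF⟩ := hf
  simp only [hfF]
  exact lintegral_comp_moebius_le hα ha1 fun z => ENNReal.ofReal (‖F z‖ ^ 2)

theorem BergmanSpace.lintegral_norm_sq [Fact (-1 < α)] (f : BergmanSpace α H) :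
    ∫⁻ z, ENNReal.ofReal (‖f z‖ ^ 2) ∂weightedArea α = ENNReal.ofReal (‖f‖ ^ 2) := by
  rw [f.norm_sq, ofReal_integral_eq_lintegral_ofReal f.integrable
    (Filter.Eventually.of_forall fun z => sq_nonneg _)]

theorem mem_bergmanSubmodule_of_lintegral_lt_top {f : Disk → H} (hf : IsAnalytic f)
    (hfin : ∫⁻ z, ENNReal.ofReal (‖f z‖ ^ 2) ∂weightedArea α < ∞) :
    f ∈ bergmanSubmodule α H := by
  refine ⟨hf, ((hf.continuous.norm.pow 2).aestronglyMeasurable), ?_⟩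
  rwa [hasFiniteIntegral_iff_ofReal (Filter.Eventually.of_forall fun z => sq_nonneg _)]

theorem exists_isCompositionOperator [Fact (-1 < α)] {Φ : Disk → Disk}
    (hΦ : IsAnalytic fun z => (Φ z : ℂ)) {C : ℝ} (hC : 0 ≤ C)
    (hbound : ∀ f : Disk → H, IsAnalytic f →
      ∫⁻ z, ENNReal.ofReal (‖f (Φ z)‖ ^ 2) ∂weightedArea α ≤
        ENNReal.ofReal (C ^ 2) * ∫⁻ z, ENNReal.ofReal (‖f z‖ ^ 2) ∂weightedArea α) :
    ∃ T : BergmanSpace α H →L[ℂ] BergmanSpace α H, IsCompositionOperator Φ T := by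
  have hmem : ∀ f : BergmanSpace α H, (f : Disk → H) ∘ Φ ∈ bergmanSubmodule α H := fun f => by
    refine mem_bergmanSubmodule_of_lintegral_lt_top (f.isAnalytic.comp hΦ)
      ((hbound f f.isAnalytic).trans_lt ?_)
    rw [f.lintegral_norm_sq]
    exact ENNReal.mul_lt_top ENNReal.ofReal_lt_top ENNReal.ofReal_lt_top
  let L : BergmanSpace α H →ₗ[ℂ] BergmanSpace α H :=
    { toFun := fun f => ⟨f ∘ Φ, hmem f⟩
      map_add' := fun f g => rfl
      map_smul' := fun c f => rfl }
  refine ⟨L.mkContinuous C fun f => ?_, fun f z => rfl⟩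
  have h : ENNReal.ofReal (‖L f‖ ^ 2) ≤ ENNReal.ofReal (C ^ 2 * ‖f‖ ^ 2) := by
    rw [ENNReal.ofReal_mul (sq_nonneg C), ← BergmanSpace.lintegral_norm_sq,
      ← BergmanSpace.lintegral_norm_sq]
    exact hbound f f.isAnalytic
  rw [ENNReal.ofReal_le_ofReal_iff (by positivity), ← mul_pow] at h
  exact le_of_sq_le_sq h (by positivity)

theorem IsCompositionOperator.norm_apply_le [CompleteSpace H] [Fact (-1 < α)] {Φ : Disk → Disk}
    {T : BergmanSpace α H →L[ℂ] BergmanSpace α H} (hT : IsCompositionOperator Φ T)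
    (hΦ : IsAnalytic fun z => (Φ z : ℂ)) (h0 : Φ 0 = 0) (f : BergmanSpace α H) :
    ‖T f‖ ≤ ‖f‖ := by
  have h := lintegral_norm_sq_comp_le_of_map_zero α f.isAnalytic hΦ h0
  rw [f.lintegral_norm_sq, lintegral_congr fun z => by rw [← hT f z], (T f).lintegral_norm_sq,
    ENNReal.ofReal_le_ofReal_iff (by positivity)] at h
  exact le_of_sq_le_sq h (norm_nonneg f)

/-! ### Test functions and the lower bound for the norm -/

theorem isFiniteMeasure_weightedArea (hα : -1 < α) : IsFiniteMeasure (weightedArea α) :=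
  ⟨measure_weightedArea_univ_lt_top hα⟩

theorem measureReal_weightedArea_pos (hα : -1 < α) : 0 < (weightedArea α).real univ := by
  have := isOpenPosMeasure_weightedArea hα
  refine ENNReal.toReal_pos (isOpen_univ.measure_pos _ ⟨0, mem_univ _⟩).ne'
    (measure_weightedArea_univ_lt_top hα).ne

theorem affine_mem_bergmanSubmodule (hα : -1 < α) (c : ℂ) (v : H) :
    (fun z : Disk => (1 + c * (z : ℂ)) • v) ∈ bergmanSubmodule α H := by
  have hfin := isFiniteMeasure_weightedArea hα
  have han : IsAnalytic fun z : Disk => (1 + c * (z : ℂ)) • v :=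
    ⟨fun z => (1 + c * z) • v, fun z _ => by fun_prop, fun _ => rfl⟩
  refine ⟨han, (integrable_const (((1 + ‖c‖) * ‖v‖) ^ 2)).mono'
    (han.continuous.norm.pow 2).aestronglyMeasurable (Filter.Eventually.of_forall fun z => ?_)⟩
  have hz : ‖(z : ℂ)‖ < 1 := mem_ball_zero_iff.1 z.2
  have h1 : ‖1 + c * (z : ℂ)‖ ≤ 1 + ‖c‖ := by
    refine (norm_add_le _ _).trans ?_
    rw [norm_one, norm_mul]
    nlinarith [norm_nonneg c, norm_nonneg (z : ℂ)]
  rw [norm_pow, norm_norm, norm_smul]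
  gcongr

/-- The affine function `z ↦ (1 + c z) v`, as an element of the Bergman space. -/
def affine [hα : Fact (-1 < α)] (c : ℂ) (v : H) : BergmanSpace α H :=
  ⟨_, affine_mem_bergmanSubmodule hα.out c v⟩

theorem affine_apply [Fact (-1 < α)] (c : ℂ) (v : H) (z : Disk) :
    (affine c v : BergmanSpace α H) z = (1 + c * (z : ℂ)) • v := rfl

theorem exists_isCompositionOperator_of_isAnalytic [CompleteSpace H] [hα : Fact (-1 < α)]
    {Φ : Disk → Disk} (hΦ : IsAnalytic fun z => (Φ z : ℂ)) :
    ∃ T : BergmanSpace α H →L[ℂ] BergmanSpace α H, IsCompositionOperator Φ T := by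
  obtain ⟨C, hC, hbound⟩ := exists_lintegral_norm_sq_comp_le (H := H) hα.out hΦ
  exact exists_isCompositionOperator hΦ hC hbound

/-- This is the contraction property for the zero map, whose composition operator sends `f` to the
constant `f 0`. -/
theorem norm_sq_zero_mul_measure_le [CompleteSpace H] [hα : Fact (-1 < α)]
    (f : BergmanSpace α H) : ‖f 0‖ ^ 2 * (weightedArea α).real univ ≤ ‖f‖ ^ 2 := by
  have h0 : IsAnalytic fun _ : Disk => ((0 : Disk) : ℂ) :=
    ⟨fun _ => ((0 : Disk) : ℂ), analyticOnNhd_const, fun _ => rfl⟩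
  obtain ⟨T, hT⟩ := exists_isCompositionOperator_of_isAnalytic (α := α) (H := H)
    (Φ := fun _ => 0) h0
  have h := pow_le_pow_left₀ (norm_nonneg _) (hT.norm_apply_le h0 rfl f) 2
  rw [(T f).norm_sq] at h
  simpa [hT f, mul_comm] using h

/-- The map `z ↦ -z` fixes `0`, so it induces a contraction; applying this to `c` and `-c` gives
equality. -/
theorem norm_affine_neg [CompleteSpace H] [Fact (-1 < α)] (c : ℂ) (v : H) :
    ‖(affine (-c) v : BergmanSpace α H)‖ = ‖(affine c v : BergmanSpace α H)‖ := by
  have hneg : IsAnalytic fun z : Disk => ((-z : Disk) : ℂ) :=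
    ⟨fun z => -z, fun z _ => by fun_prop, fun _ => rfl⟩
  obtain ⟨T, hT⟩ := exists_isCompositionOperator_of_isAnalytic (α := α) (H := H)
    (Φ := fun z => -z) hneg
  have h : ∀ d : ℂ, T (affine d v) = affine (-d) v := fun d =>
    DFunLike.ext _ _ fun z => by
      rw [hT, affine_apply, affine_apply]
      simp
  have hle : ∀ d : ℂ, ‖(affine (-d) v : BergmanSpace α H)‖ ≤
      ‖(affine d v : BergmanSpace α H)‖ := fun d => by
    rw [← h]
    exact hT.norm_apply_le hneg (Subtype.ext (by simp)) _
  exact (hle c).antisymm (by simpa using hle (-c))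

/-- Averaging over `c` and `-c` removes the cross term: pointwise, the parallelogram law gives `|1 +
cz|² + |1 - cz|² = 2 + 2|cz|²`. -/
theorem norm_affine_sq_le [CompleteSpace H] [hα : Fact (-1 < α)] (c : ℂ) {v : H}
    (hv : ‖v‖ = 1) :
    ‖(affine c v : BergmanSpace α H)‖ ^ 2 ≤ (1 + ‖c‖ ^ 2) * (weightedArea α).real univ := by
  have hfin := isFiniteMeasure_weightedArea hα.out
  have h1 : ‖(affine c v : BergmanSpace α H)‖ ^ 2 + ‖(affine (-c) v : BergmanSpace α H)‖ ^ 2 ≤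
      2 * ((1 + ‖c‖ ^ 2) * (weightedArea α).real univ) := by
    rw [BergmanSpace.norm_sq, BergmanSpace.norm_sq,
      ← integral_add (affine c v : BergmanSpace α H).integrable
        (affine (-c) v : BergmanSpace α H).integrable]
    have h2 : ∫ _ : Disk, 2 * (1 + ‖c‖ ^ 2) ∂weightedArea α =
        2 * ((1 + ‖c‖ ^ 2) * (weightedArea α).real univ) := by
      rw [integral_const, smul_eq_mul]
      ring
    rw [← h2]
    refine integral_mono ((affine c v : BergmanSpace α H).integrable.add
        (affine (-c) v : BergmanSpace α H).integrable) (integrable_const _) fun z => ?_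
    have hz : ‖(z : ℂ)‖ < 1 := mem_ball_zero_iff.1 z.2
    have h3 := parallelogram_law_with_norm ℝ (1 : ℂ) (c * z)
    have h4 : ‖c * (z : ℂ)‖ ^ 2 ≤ ‖c‖ ^ 2 := by
      rw [norm_mul]
      gcongr
      exact mul_le_of_le_one_right (norm_nonneg c) hz.le
    simp only [affine_apply, norm_smul, hv, mul_one, neg_mul, ← sub_eq_add_neg]
    rw [norm_one] at h3
    nlinarith
  rw [norm_affine_neg] at h1
  linarith

theorem norm_affine_zero_pos [hα : Fact (-1 < α)] {v : H} (hv : v ≠ 0) :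
    0 < ‖(affine 0 v : BergmanSpace α H)‖ := by
  refine norm_pos_iff.2 fun h => hv ?_
  have := congrArg (fun f : BergmanSpace α H => f 0) h
  simpa [affine_apply, BergmanSpace.zero_apply] using this

theorem IsCompositionOperator.one_le_norm [Nontrivial H] [Fact (-1 < α)] {Φ : Disk → Disk}
    {T : BergmanSpace α H →L[ℂ] BergmanSpace α H} (hT : IsCompositionOperator Φ T) :
    1 ≤ ‖T‖ := by
  obtain ⟨v, hv⟩ := exists_ne (0 : H)
  have hfix : T (affine 0 v) = affine 0 v := DFunLike.ext _ _ fun z => by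
    rw [hT, affine_apply, affine_apply]
    simp
  have h := T.le_opNorm (affine 0 v)
  rw [hfix] at h
  exact le_of_mul_le_mul_right (by rwa [one_mul]) (norm_affine_zero_pos (α := α) hv)

theorem IsCompositionOperator.one_add_norm_sq_le [CompleteSpace H] [Nontrivial H]
    [hα : Fact (-1 < α)] {Φ : Disk → Disk} {T : BergmanSpace α H →L[ℂ] BergmanSpace α H}
    (hT : IsCompositionOperator Φ T) : 1 + ‖(Φ 0 : ℂ)‖ ^ 2 ≤ ‖T‖ ^ 2 := by
  obtain ⟨v, hv⟩ := exists_norm_eq H zero_le_one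
  have hM := measureReal_weightedArea_pos hα.out
  set M := (weightedArea α).real univ
  -- With this `c`, the image function has norm `s = 1 + |Φ 0|²` at `0`, while the test function has
  -- squared norm at most `s M`. Hence `s² M ≤ ‖T‖² s M`.
  set c := (starRingEnd ℂ) (Φ 0 : ℂ) with hc
  have hcn : ‖c‖ = ‖(Φ 0 : ℂ)‖ := RCLike.norm_conj _
  have h1 := norm_sq_zero_mul_measure_le (T (affine c v))
  have h2 := norm_affine_sq_le (α := α) c hv
  have h3 := pow_le_pow_left₀ (norm_nonneg _) (T.le_opNorm (affine c v)) 2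
  have hval : ‖T (affine c v) 0‖ = 1 + ‖(Φ 0 : ℂ)‖ ^ 2 := by
    rw [hT, affine_apply, norm_smul, hv, mul_one, hc, conj_mul']
    norm_cast
    rw [Real.norm_of_nonneg (by positivity)]
  rw [hval] at h1
  rw [hcn] at h2
  rw [mul_pow] at h3
  set s := 1 + ‖(Φ 0 : ℂ)‖ ^ 2
  have hspos : 0 < s := by positivity
  have h4 : s ^ 2 * M ≤ ‖T‖ ^ 2 * (s * M) :=
    (h1.trans h3).trans (mul_le_mul_of_nonneg_left h2 (sq_nonneg _))
  refine le_of_mul_le_mul_right ?_ (mul_pos hspos hM)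
  linarith [h4, show s ^ 2 * M = s * (s * M) by ring]

end Composition

end VectorBergman

end

theorem mainTheorem1 (α : ℝ) [Fact (-1 < α)] (H : Type*) [NormedAddCommGroup H]
    [InnerProductSpace ℂ H] [CompleteSpace H] [TopologicalSpace.SeparableSpace H] [Nontrivial H]
    (Φ : VectorBergman.Disk → VectorBergman.Disk)
    (hΦ : VectorBergman.IsAnalytic fun z => (Φ z : ℂ)) :
    ∃ CΦ : VectorBergman.BergmanSpace α H →L[ℂ] VectorBergman.BergmanSpace α H,
      VectorBergman.IsCompositionOperator Φ CΦ ∧ (‖CΦ‖ = 1 ↔ Φ 0 = 0) := by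
  obtain ⟨T, hT⟩ :=
    VectorBergman.exists_isCompositionOperator_of_isAnalytic (α := α) (H := H) hΦ
  refine ⟨T, hT, fun h => ?_, fun h0 => le_antisymm ?_ hT.one_le_norm⟩
  · have h1 := hT.one_add_norm_sq_le
    rw [h, one_pow] at h1
    have h2 : ‖(Φ 0 : ℂ)‖ = 0 := pow_eq_zero_iff two_ne_zero |>.1
      (le_antisymm (by linarith) (sq_nonneg _))
    exact Subtype.ext (norm_eq_zero.1 h2)
  · exact T.opNorm_le_bound zero_le_one fun f => by
      rw [one_mul]
      exact hT.norm_apply_le hΦ h0 f
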